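/- Let $F$ be a field of characteristic different from $2$ and let $A$ be a Novikov algebra over $F$, that is, a (not necessarily associative or unital) $F$-algebra satisfying $(x,y,z)=(y,x,z)$ and $(xy)z=(xz)y$ for all $x,y,z\in A$, where $(x,y,z)=(xy)z-x(yz)$. Put $A^{(0)_L}=A$ and let $A^{(n+1)_L}$ be the subspace spanned by all commutators $xy-yx$ with $x,y\in A^{(n)_L}$; assume that $A$ is Lie-solvable, i.e. $A^{(n)_L}=0$ for some $n\ge 0$. An algebra $R$ is called left-quasiregular if for every $x\in R$ there is $y\in R$ with $x+y=yx$. Let $J(A)$, the left-quasiregular radical of $A$, be the sum of all two-sided ideals of $A$ that are left-quasiregular as algebras. Then $J(A)$ is itself left-quasiregular (so it is the largest left-quasiregular ideal of $A$), and $$J(A)=\bigcap\{\,I : I \text{ is a two-sided ideal of } A \text{ such that } A/I \text{ is a field}\,\},$$ where the intersection of the empty family is $A$. Here "$A/I$ is a field" means that $A/I$ is commutative and associative, has an identity element $e\neq 0$, and each of its nonzero elements is invertible. -/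

import Mathlib

/-- A Novikov ring: the associator `(x, y, z) = (x * y) * z - x * (y * z)` is symmetric in
its first two arguments (this is `LeftPreLieRing`), and right multiplications commute. A Novikov
algebra over a field `F` is a Novikov ring with a compatible `F`-module structure. -/
class NovikovRing (A : Type*) extends LeftPreLieRing A where
  /-- The identity `(x y) z = (x z) y`. -/
  right_comm : ∀ x y z : A, (x * y) * z = (x * z) * y

/-- The Lie-solvable powers: the whole algebra in degree `0`, and in degree `n + 1` the subspace
spanned by all commutators of elements of the `n`-th power. -/
def lieSolvablePower (F A : Type*) [Field F] [NonUnitalNonAssocRing A] [Module F A] :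
    ℕ → Submodule F A
  | 0 => ⊤
  | n + 1 => Submodule.span F {z : A | ∃ x ∈ lieSolvablePower F A n,
      ∃ y ∈ lieSolvablePower F A n, z = x * y - y * x}

/-- An algebra is Lie-solvable if one of its Lie-solvable powers is zero. -/
def IsLieSolvableAlgebra (F A : Type*) [Field F] [NonUnitalNonAssocRing A] [Module F A] : Prop :=
  ∃ n : ℕ, lieSolvablePower F A n = ⊥

/-- An ideal of a (not necessarily associative or unital) `F`-algebra: a subspace that is stable
under left and right multiplication by arbitrary elements. -/
structure AlgIdeal (F A : Type*) [Field F] [NonUnitalNonAssocRing A] [Module F A] extends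
    Submodule F A where
  left_mul_mem : ∀ (a : A) {x : A}, x ∈ toSubmodule → a * x ∈ toSubmodule
  right_mul_mem : ∀ (a : A) {x : A}, x ∈ toSubmodule → x * a ∈ toSubmodule

/-- An element `x` is left-quasiregular if `x + y = y x` for some `y`. -/
def IsLeftQuasiregularElt {R : Type*} [NonUnitalNonAssocRing R] (x : R) : Prop :=
  ∃ y : R, x + y = y * x

/-- An algebra is left-quasiregular if all its elements are. -/
def IsLeftQuasiregularAlgebra (R : Type*) [NonUnitalNonAssocRing R] : Prop :=
  ∀ x : R, IsLeftQuasiregularElt x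

/-- `R` is a field: commutative, associative, with an identity element `e ≠ 0`, and every nonzero
element is invertible. -/
def IsFieldAlgebra (R : Type*) [NonUnitalNonAssocRing R] : Prop :=
  (∀ x y : R, x * y = y * x) ∧ (∀ x y z : R, (x * y) * z = x * (y * z)) ∧
    ∃ e : R, e ≠ 0 ∧ (∀ x : R, e * x = x) ∧ ∀ x : R, x ≠ 0 → ∃ y : R, x * y = e

namespace AlgIdeal

variable {F A : Type*} [Field F] [NonUnitalNonAssocRing A] [Module F A]

/-- An ideal regarded as a subalgebra, hence as an algebra in its own right. -/
def toSubalgebra (I : AlgIdeal F A) : NonUnitalSubalgebra F A where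
  toNonUnitalSubsemiring :=
    { carrier := {x : A | x ∈ I.toSubmodule}
      add_mem' := fun hx hy => I.toSubmodule.add_mem hx hy
      zero_mem' := I.toSubmodule.zero_mem
      mul_mem' := fun {x _} _ hy => I.left_mul_mem x hy }
  smul_mem' := fun c _ hx => I.toSubmodule.smul_mem c hx

/-- The underlying space of the quotient algebra `A / I`. -/
def Quot (I : AlgIdeal F A) : Type _ := A ⧸ I.toSubmodule

instance (I : AlgIdeal F A) : AddCommGroup I.Quot :=
  inferInstanceAs (AddCommGroup (A ⧸ I.toSubmodule))

instance (I : AlgIdeal F A) : Module F I.Quot :=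
  inferInstanceAs (Module F (A ⧸ I.toSubmodule))

/-- The class of `a` in the quotient algebra. -/
def toQuot (I : AlgIdeal F A) (a : A) : I.Quot := Submodule.Quotient.mk (p := I.toSubmodule) a

/-- The multiplication of the quotient algebra, `(a + I) (b + I) = a b + I`. -/
instance (I : AlgIdeal F A) : Mul I.Quot where
  mul := Quotient.map₂ (fun a b : A => a * b) (by
    intro a a' ha b b' hb
    have ha' : a - a' ∈ I.toSubmodule := (Submodule.quotientRel_def _).1 ha
    have hb' : b - b' ∈ I.toSubmodule := (Submodule.quotientRel_def _).1 hb
    refine (Submodule.quotientRel_def _).2 ?_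
    have h : a * b - a' * b' = a * (b - b') + (a - a') * b' := by
      rw [mul_sub, sub_mul]; abel
    rw [h]
    exact I.toSubmodule.add_mem (I.left_mul_mem a hb') (I.right_mul_mem b' ha'))

theorem toQuot_mul (I : AlgIdeal F A) (a b : A) : I.toQuot (a * b) = I.toQuot a * I.toQuot b := rfl

theorem toQuot_add (I : AlgIdeal F A) (a b : A) : I.toQuot (a + b) = I.toQuot a + I.toQuot b := rfl

theorem toQuot_surjective (I : AlgIdeal F A) : Function.Surjective I.toQuot :=
  Submodule.Quotient.mk_surjective _

instance (I : AlgIdeal F A) : NonUnitalNonAssocRing I.Quot where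
  left_distrib x y z := by
    obtain ⟨a, rfl⟩ := I.toQuot_surjective x
    obtain ⟨b, rfl⟩ := I.toQuot_surjective y
    obtain ⟨c, rfl⟩ := I.toQuot_surjective z
    simp only [← toQuot_mul, ← toQuot_add, mul_add]
  right_distrib x y z := by
    obtain ⟨a, rfl⟩ := I.toQuot_surjective x
    obtain ⟨b, rfl⟩ := I.toQuot_surjective y
    obtain ⟨c, rfl⟩ := I.toQuot_surjective z
    simp only [← toQuot_mul, ← toQuot_add, add_mul]
  zero_mul x := by
    obtain ⟨a, rfl⟩ := I.toQuot_surjective x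
    change I.toQuot 0 * I.toQuot a = I.toQuot 0
    rw [← toQuot_mul, zero_mul]
  mul_zero x := by
    obtain ⟨a, rfl⟩ := I.toQuot_surjective x
    change I.toQuot a * I.toQuot 0 = I.toQuot 0
    rw [← toQuot_mul, mul_zero]

end AlgIdeal

/-- The left-quasiregular radical: the sum of all left-quasiregular ideals. -/
def leftQuasiregularRadical (F A : Type*) [Field F] [NonUnitalNonAssocRing A] [Module F A] :
    AlgIdeal F A where
  toSubmodule := sSup {S : Submodule F A | ∃ I : AlgIdeal F A,
    IsLeftQuasiregularAlgebra I.toSubalgebra ∧ S = I.toSubmodule}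
  left_mul_mem a x hx := by
    rw [sSup_eq_iSup'] at hx ⊢
    induction hx using Submodule.iSup_induction' with
    | mem i x hi =>
      obtain ⟨I, _, h⟩ := i.2
      refine Submodule.mem_iSup_of_mem i ?_
      rw [h] at hi ⊢
      exact I.left_mul_mem a hi
    | zero => rw [mul_zero]; exact Submodule.zero_mem _
    | add x y _ _ hx hy => rw [mul_add]; exact Submodule.add_mem _ hx hy
  right_mul_mem a x hx := by
    rw [sSup_eq_iSup'] at hx ⊢
    induction hx using Submodule.iSup_induction' with
    | mem i x hi =>
      obtain ⟨I, _, h⟩ := i.2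
      refine Submodule.mem_iSup_of_mem i ?_
      rw [h] at hi ⊢
      exact I.right_mul_mem a hi
    | zero => rw [zero_mul]; exact Submodule.zero_mem _
    | add x y _ _ hx hy => rw [add_mul]; exact Submodule.add_mem _ hx hy

/-! In characteristic not 2, `C = [A, A]` is an ideal and `A / C` is commutative and associative. If
`x` lies in every ideal with field quotient, a Zorn argument as for commutative rings makes `x`
quasiregular modulo `C` (`exists_add_sub_mul_mem_commutatorSpan`). To lift this to `A`, consider the
right ideal `M = {a - a x}`. Quasiregularity modulo `C` gives `A = M + A C`. If `L ⊆ C` is an ideal,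
a power of `L` lies in `[L, L]`, so `A = M + A L` implies `A = M + A [L, L]`. Lie-solvability then
forces `M = A`, and `-x ∈ M` is quasiregularity of `x`. Conversely, a quasiregular ideal not inside
`I` would contain a preimage of the identity of the field `A / I`, which is not quasiregular. -/

theorem NovikovRing.left_symm {A : Type*} [NovikovRing A] (x y z : A) :
    x * (y * z) = (x * y) * z - (y * x) * z + y * (x * z) := by
  have h := LeftPreLieRing.assoc_symm' x y z
  simp only [associator] at h
  rw [sub_eq_sub_iff_add_eq_add] at h
  have h' : x * (y * z) = (x * y) * z + y * (x * z) - (y * x) * z := by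
    rw [h]; abel
  rw [h']; abel

/-- `2 [a, b] c = [a c, b] - [b c, a]` in a Novikov ring. -/
theorem commutator_mul_add_self {A : Type*} [NovikovRing A] (a b c : A) :
    (a * b - b * a) * c + (a * b - b * a) * c =
      ((a * c) * b - b * (a * c)) - ((b * c) * a - a * (b * c)) := by
  rw [NovikovRing.left_symm b a c, sub_mul, NovikovRing.right_comm a c b,
    NovikovRing.right_comm b c a]
  abel

theorem commutator_leibniz {A : Type*} [NovikovRing A] (a b c : A) :
    a * (b * c - c * b) - (b * c - c * b) * a =
      ((a * b - b * a) * c - c * (a * b - b * a)) +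
        (b * (a * c - c * a) - (a * c - c * a) * b) := by
  simp only [mul_sub, sub_mul]
  rw [NovikovRing.left_symm a b c, NovikovRing.left_symm a c b, NovikovRing.left_symm c b a]
  abel

/-! ### Commutators and products of ideals. -/

section NovikovIdeals

variable {F A : Type*} [Field F] [NovikovRing A] [Module F A]

/-- A subspace stable under left and right multiplication by arbitrary elements. -/
structure IsTwoSidedSubmodule (S : Submodule F A) : Prop where
  left_mul_mem : ∀ (a : A) {x : A}, x ∈ S → a * x ∈ S
  right_mul_mem : ∀ (a : A) {x : A}, x ∈ S → x * a ∈ S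

/-- The subspace spanned by the commutators `s * t - t * s`. -/
def commutatorSpan (S T : Submodule F A) : Submodule F A :=
  Submodule.span F {z : A | ∃ x ∈ S, ∃ y ∈ T, z = x * y - y * x}

theorem sub_mem_commutatorSpan {S T : Submodule F A} {s t : A} (hs : s ∈ S) (ht : t ∈ T) :
    s * t - t * s ∈ commutatorSpan S T :=
  Submodule.subset_span ⟨s, hs, t, ht, rfl⟩

theorem commutatorSpan_le {S T U : Submodule F A} :
    commutatorSpan S T ≤ U ↔ ∀ s ∈ S, ∀ t ∈ T, s * t - t * s ∈ U := by
  refine Submodule.span_le.trans ⟨fun h s hs t ht => h ⟨s, hs, t, ht, rfl⟩, ?_⟩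
  rintro h _ ⟨s, hs, t, ht, rfl⟩
  exact h s hs t ht

theorem mem_of_add_self_mem (h2 : (2 : F) ≠ 0) {S : Submodule F A} {x : A} (h : x + x ∈ S) :
    x ∈ S := by
  rw [← two_smul F x] at h
  exact (S.smul_mem_iff h2).1 h

theorem isTwoSidedSubmodule_top : IsTwoSidedSubmodule (⊤ : Submodule F A) :=
  ⟨fun _ _ _ => trivial, fun _ _ _ => trivial⟩

/-- Modulo `[L, L]`, the map `[a, ·]` on an ideal `L` satisfies `[a, c d] = 2 [a, c] d`. -/
theorem commutator_mul_sub_mem {L : Submodule F A} (hL : IsTwoSidedSubmodule L) (a : A) {c d : A}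
    (hc : c ∈ L) (hd : d ∈ L) :
    (a * (c * d) - (c * d) * a) - ((a * c - c * a) * d + (a * c - c * a) * d) ∈
      commutatorSpan L L := by
  have h := sub_mem_commutatorSpan hc (hL.left_mul_mem a hd)
  have e : (a * (c * d) - (c * d) * a) - ((a * c - c * a) * d + (a * c - c * a) * d) =
      c * (a * d) - (a * d) * c := by
    rw [NovikovRing.left_symm a c d, sub_mul, NovikovRing.right_comm c d a,
      NovikovRing.right_comm a d c]
    abel
  rwa [e]

theorem lieSolvablePower_succ_le (n : ℕ) :
    lieSolvablePower F A (n + 1) ≤ commutatorSpan ⊤ ⊤ :=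
  commutatorSpan_le.2 fun _ _ _ _ => sub_mem_commutatorSpan trivial trivial

variable [IsScalarTower F A A] [SMulCommClass F A A]

/-- The subspace spanned by the products `s * t`. -/
def mulSpan (S T : Submodule F A) : Submodule F A := Submodule.map₂ (LinearMap.mul F A) S T

theorem mul_mem_mulSpan {S T : Submodule F A} {s t : A} (hs : s ∈ S) (ht : t ∈ T) :
    s * t ∈ mulSpan S T :=
  Submodule.apply_mem_map₂ (LinearMap.mul F A) hs ht

theorem mulSpan_le {S T U : Submodule F A} :
    mulSpan S T ≤ U ↔ ∀ s ∈ S, ∀ t ∈ T, s * t ∈ U :=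
  Submodule.map₂_le

theorem mulSpan_mono {S S' T T' : Submodule F A} (h : S ≤ S') (h' : T ≤ T') :
    mulSpan S T ≤ mulSpan S' T' :=
  Submodule.map₂_le_map₂ h h'

theorem mul_right_mem_of_mem_mulSpan {S T U : Submodule F A} (a : A)
    (h : ∀ s ∈ S, ∀ t ∈ T, (s * t) * a ∈ U) {x : A} (hx : x ∈ mulSpan S T) : x * a ∈ U :=
  (mulSpan_le (U := U.comap (LinearMap.mulRight F a))).2 h hx

theorem mul_left_mem_of_mem_mulSpan {S T U : Submodule F A} (a : A)
    (h : ∀ s ∈ S, ∀ t ∈ T, a * (s * t) ∈ U) {x : A} (hx : x ∈ mulSpan S T) : a * x ∈ U :=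
  (mulSpan_le (U := U.comap (LinearMap.mulLeft F a))).2 h hx

theorem IsTwoSidedSubmodule.mulSpan {S T : Submodule F A} (hS : IsTwoSidedSubmodule S)
    (hT : IsTwoSidedSubmodule T) : IsTwoSidedSubmodule (mulSpan S T) where
  left_mul_mem a x hx := mul_left_mem_of_mem_mulSpan a (fun s hs t ht => by
    rw [NovikovRing.left_symm]
    exact add_mem (sub_mem (mul_mem_mulSpan (hS.left_mul_mem a hs) ht)
      (mul_mem_mulSpan (hS.right_mul_mem a hs) ht)) (mul_mem_mulSpan hs (hT.left_mul_mem a ht))) hx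
  right_mul_mem a x hx := mul_right_mem_of_mem_mulSpan a (fun s hs t ht => by
    rw [NovikovRing.right_comm]
    exact mul_mem_mulSpan (hS.right_mul_mem a hs) ht) hx

theorem IsTwoSidedSubmodule.commutatorSpan (h2 : (2 : F) ≠ 0) {S : Submodule F A}
    (hS : IsTwoSidedSubmodule S) : IsTwoSidedSubmodule (commutatorSpan S S) := by
  have hr : ∀ (a : A) {x : A}, x ∈ _root_.commutatorSpan S S →
      x * a ∈ _root_.commutatorSpan S S := fun a x hx => by
    refine (commutatorSpan_le
      (U := (_root_.commutatorSpan S S).comap (LinearMap.mulRight F a))).2 ?_ hx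
    intro s hs t ht
    refine mem_of_add_self_mem (S := _root_.commutatorSpan S S)
      (x := (s * t - t * s) * a) h2 ?_
    rw [commutator_mul_add_self]
    exact sub_mem (sub_mem_commutatorSpan (hS.right_mul_mem a hs) ht)
      (sub_mem_commutatorSpan (hS.right_mul_mem a ht) hs)
  refine ⟨fun a x hx => ?_, hr⟩
  refine (commutatorSpan_le
    (U := (_root_.commutatorSpan S S).comap (LinearMap.mulLeft F a))).2 ?_ hx
  intro s hs t ht
  change a * (s * t - t * s) ∈ _root_.commutatorSpan S S
  rw [← sub_add_cancel (a * (s * t - t * s)) ((s * t - t * s) * a), commutator_leibniz]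
  exact add_mem (add_mem
    (sub_mem_commutatorSpan (sub_mem (hS.left_mul_mem a hs) (hS.right_mul_mem a hs)) ht)
    (sub_mem_commutatorSpan hs (sub_mem (hS.left_mul_mem a ht) (hS.right_mul_mem a ht))))
    (hr a (sub_mem_commutatorSpan hs ht))

theorem mulSpan_commutatorSpan_le (h2 : (2 : F) ≠ 0) {L : Submodule F A}
    (hL : IsTwoSidedSubmodule L) :
    mulSpan (commutatorSpan ⊤ ⊤) L ≤ commutatorSpan ⊤ L := by
  rw [mulSpan_le]
  intro c hc l hl
  refine (commutatorSpan_le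
    (U := (commutatorSpan ⊤ L).comap (LinearMap.mulRight F l))).2 ?_ hc
  intro a _ b _
  refine mem_of_add_self_mem (S := commutatorSpan ⊤ L) (x := (a * b - b * a) * l) h2 ?_
  have e : (a * b - b * a) * l + (a * b - b * a) * l =
      (a * (b * l) - (b * l) * a) - (b * (a * l) - (a * l) * b) := by
    rw [commutator_mul_add_self]; abel
  rw [e]
  exact sub_mem (sub_mem_commutatorSpan trivial (hL.left_mul_mem b hl))
    (sub_mem_commutatorSpan trivial (hL.left_mul_mem a hl))

/-- By right commutativity, `(p, q, r) = [p, q] r + [q r, p]`. -/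
theorem associator_mem_commutatorSpan (h2 : (2 : F) ≠ 0) {L : Submodule F A}
    (hL : IsTwoSidedSubmodule L) {p q r : A} (hp : p ∈ L) (hq : q ∈ L) :
    (p * q) * r - p * (q * r) ∈ commutatorSpan L L := by
  have h₁ := (hL.commutatorSpan h2).right_mul_mem r (sub_mem_commutatorSpan hp hq)
  have h := add_mem h₁ (sub_mem_commutatorSpan (hL.right_mul_mem r hq) hp)
  have e : (p * q - q * p) * r + ((q * r) * p - p * (q * r)) = (p * q) * r - p * (q * r) := by
    rw [sub_mul, NovikovRing.right_comm q r p]; abel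
  rwa [e] at h

/-- Put `D = [a, ·]` and work modulo `[L, L]`, where `D (c d) = 2 (D c) d` and associators vanish.
Then `D ((c d) e) = 4 (D c) d e`, while `D (c (d e)) = 2 (D c) d e`; hence `2 (D c) d e = 0`. -/
theorem commutator_mul_mul_mem (h2 : (2 : F) ≠ 0) {L : Submodule F A}
    (hL : IsTwoSidedSubmodule L) (a : A) {c d e : A} (hc : c ∈ L) (hd : d ∈ L) (he : e ∈ L) :
    ((a * c - c * a) * d) * e ∈ commutatorSpan L L := by
  have hK := hL.commutatorSpan h2
  have hac : a * c - c * a ∈ L := sub_mem (hL.left_mul_mem a hc) (hL.right_mul_mem a hc)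
  have h₁ := commutator_mul_sub_mem hL a (hL.right_mul_mem d hc) he
  have h₂ := hK.right_mul_mem e (commutator_mul_sub_mem hL a hc hd)
  have h₃ := commutator_mul_sub_mem hL a hc (hL.right_mul_mem e hd)
  have h₄ := associator_mem_commutatorSpan h2 hL (r := e) hc hd
  have h₅ := sub_mem (hK.left_mul_mem a h₄) (hK.right_mul_mem a h₄)
  have h₆ := associator_mem_commutatorSpan h2 hL (r := e) hac hd
  refine mem_of_add_self_mem h2 ?_
  have key := add_mem (sub_mem (sub_mem (sub_mem h₅ h₁) (add_mem h₂ h₂)) (add_mem h₆ h₆)) h₃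
  convert key using 1
  simp only [sub_mul, mul_sub, add_mul]
  abel

/-- `L L ⊆ [A, A] L ⊆ [A, L]`, and two further factors from `L` send `[A, L]` into `[L, L]`. -/
theorem mulSpan_four_le_commutatorSpan (h2 : (2 : F) ≠ 0) {L : Submodule F A}
    (hL : IsTwoSidedSubmodule L) (hLC : L ≤ commutatorSpan ⊤ ⊤) :
    mulSpan (mulSpan (mulSpan L L) L) L ≤ commutatorSpan L L := by
  refine (mulSpan_mono (mulSpan_mono ((mulSpan_mono hLC le_rfl).trans
    (mulSpan_commutatorSpan_le h2 hL)) le_rfl) le_rfl).trans ?_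
  rw [mulSpan_le]
  intro u hu e he
  refine mul_right_mem_of_mem_mulSpan e ?_ hu
  intro v hv d hd
  refine (commutatorSpan_le (U := (commutatorSpan L L).comap
    (LinearMap.mulRight F e ∘ₗ LinearMap.mulRight F d))).2 ?_ hv
  intro a _ c hc
  exact commutator_mul_mul_mem h2 hL a hc hd he

theorem mulSpan_four_le_mulSpan_top {L : Submodule F A} (hL : IsTwoSidedSubmodule L) :
    mulSpan (mulSpan (mulSpan L L) L) L ≤ mulSpan ⊤ (mulSpan L L) := by
  have hI := isTwoSidedSubmodule_top.mulSpan (hL.mulSpan hL)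
  rw [mulSpan_le]
  intro w hw l hl
  refine mul_right_mem_of_mem_mulSpan l ?_ hw
  intro u hu k hk
  have h₁ := hI.right_mul_mem l (mul_mem_mulSpan (Submodule.mem_top (x := k)) hu)
  have huL : u ∈ L := mulSpan_le.2 (fun s hs t _ => hL.right_mul_mem t hs) hu
  have h₂ := mul_mem_mulSpan (Submodule.mem_top (x := k)) (mul_mem_mulSpan huL hl)
  have h₃ := mul_mem_mulSpan (Submodule.mem_top (x := u)) (mul_mem_mulSpan hk hl)
  -- Left symmetry; each term on the right lies in the ideal `A (L L)`.
  have e : (u * k) * l = u * (k * l) + (k * u) * l - k * (u * l) := by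
    rw [NovikovRing.left_symm u k l]; abel
  rw [e]
  exact sub_mem (add_mem h₃ h₁) h₂

/-! ### Descent along the derived series. -/

variable {M : Submodule F A}

/-- If a right ideal `M` satisfies `M + A L = A`, then `M + ((A L) L ...) L = A`. -/
theorem top_le_sup_mulSpan_of_top_le (hM : ∀ (a : A) {x : A}, x ∈ M → x * a ∈ M)
    {L U : Submodule F A} (hL : ⊤ ≤ M ⊔ mulSpan ⊤ L) (hU : ⊤ ≤ M ⊔ U) :
    ⊤ ≤ M ⊔ mulSpan U L := by
  refine hL.trans (sup_le le_sup_left (mulSpan_le.2 fun a _ l hl => ?_))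
  obtain ⟨m, hm, u, hu, rfl⟩ := Submodule.mem_sup.1 (hU (Submodule.mem_top (x := a)))
  rw [add_mul]
  exact Submodule.add_mem_sup (hM l hm) (mul_mem_mulSpan hu hl)

theorem top_le_sup_mulSpan_mulSpan (hM : ∀ (a : A) {x : A}, x ∈ M → x * a ∈ M)
    {L : Submodule F A} (hLI : IsTwoSidedSubmodule L) (hL : ⊤ ≤ M ⊔ mulSpan ⊤ L) :
    ⊤ ≤ M ⊔ mulSpan ⊤ (mulSpan L L) := by
  have h₀ : ⊤ ≤ M ⊔ L :=
    hL.trans (sup_le_sup_left (mulSpan_le.2 fun a _ l hl => hLI.left_mul_mem a hl) M)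
  have h := fun U => top_le_sup_mulSpan_of_top_le (U := U) hM hL
  exact (h _ (h _ (h _ h₀))).trans (sup_le_sup_left (mulSpan_four_le_mulSpan_top hLI) M)

theorem top_le_sup_mulSpan_commutatorSpan (h2 : (2 : F) ≠ 0)
    (hM : ∀ (a : A) {x : A}, x ∈ M → x * a ∈ M) {L : Submodule F A}
    (hLI : IsTwoSidedSubmodule L) (hLC : L ≤ commutatorSpan ⊤ ⊤) (hL : ⊤ ≤ M ⊔ mulSpan ⊤ L) :
    ⊤ ≤ M ⊔ mulSpan ⊤ (commutatorSpan L L) := by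
  have hsub : ∀ {S : Submodule F A}, IsTwoSidedSubmodule S → mulSpan S S ≤ S := fun hS =>
    mulSpan_le.2 fun s hs t _ => hS.right_mul_mem t hs
  -- Three squarings are used: `(L² L²)(L² L²)` lies in the left-nested fourth power `((L L) L) L`.
  have i₁ := hLI.mulSpan hLI
  have i₂ := i₁.mulSpan i₁
  have h := top_le_sup_mulSpan_mulSpan hM i₂
    (top_le_sup_mulSpan_mulSpan hM i₁ (top_le_sup_mulSpan_mulSpan hM hLI hL))
  refine h.trans (sup_le_sup_left (mulSpan_mono le_rfl ?_) M)
  refine le_trans ?_ (mulSpan_four_le_commutatorSpan h2 hLI hLC)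
  exact mulSpan_mono (mulSpan_mono le_rfl (hsub hLI)) ((hsub i₁).trans (hsub hLI))

theorem isTwoSidedSubmodule_lieSolvablePower (h2 : (2 : F) ≠ 0) (n : ℕ) :
    IsTwoSidedSubmodule (lieSolvablePower F A n) := by
  induction n with
  | zero => exact isTwoSidedSubmodule_top
  | succ n ih => exact ih.commutatorSpan h2

/-- In a Lie-solvable Novikov algebra, a right ideal that generates `A` together with `A [A, A]`
is all of `A`. -/
theorem IsLieSolvableAlgebra.top_le_of_top_le_sup (h2 : (2 : F) ≠ 0)
    (hA : IsLieSolvableAlgebra F A) (hM : ∀ (a : A) {x : A}, x ∈ M → x * a ∈ M)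
    (h : ⊤ ≤ M ⊔ mulSpan ⊤ (commutatorSpan ⊤ ⊤)) : ⊤ ≤ M := by
  -- The index starts at 1 because the descent needs powers inside `[A, A]`.
  have key : ∀ n, ⊤ ≤ M ⊔ mulSpan ⊤ (lieSolvablePower F A (n + 1)) := by
    intro n
    induction n with
    | zero => exact h
    | succ n ih =>
      exact top_le_sup_mulSpan_commutatorSpan h2 hM
        (isTwoSidedSubmodule_lieSolvablePower h2 _) (lieSolvablePower_succ_le n) ih
  obtain ⟨n, hn⟩ := hA
  refine (key n).trans (sup_le le_rfl (mulSpan_le.2 fun a _ z hz => ?_))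
  have hz' : z ∈ (⊥ : Submodule F A) := by
    refine (commutatorSpan_le (S := lieSolvablePower F A n) (T := lieSolvablePower F A n)
      (U := ⊥)).2 ?_ hz
    intro s hs t ht
    rw [hn, Submodule.mem_bot] at hs
    simp [hs]
  rw [(Submodule.mem_bot F).1 hz', mul_zero]
  exact zero_mem _

/-! ### Lifting quasiregularity from `A / [A, A]`. -/

/-- An element that is left-quasiregular modulo `[A, A]` is left-quasiregular. -/
theorem IsLieSolvableAlgebra.isLeftQuasiregularElt (h2 : (2 : F) ≠ 0)
    (hA : IsLieSolvableAlgebra F A) {x y : A}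
    (hxy : x + y - y * x ∈ commutatorSpan (F := F) (⊤ : Submodule F A) ⊤) :
    IsLeftQuasiregularElt x := by
  have hC := isTwoSidedSubmodule_top.commutatorSpan (F := F) (A := A) h2
  have hAC := isTwoSidedSubmodule_top.mulSpan hC
  set C := commutatorSpan (F := F) (⊤ : Submodule F A) ⊤
  set M : Submodule F A := LinearMap.range (LinearMap.id - LinearMap.mulRight F x)
  have hmem : ∀ a, a - a * x ∈ M := fun a => ⟨a, rfl⟩
  have hM : ∀ (a : A) {z : A}, z ∈ M → z * a ∈ M := by
    rintro a _ ⟨z, rfl⟩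
    refine ⟨z * a, ?_⟩
    simp [sub_mul, NovikovRing.right_comm z a x]
  have hMC : ⊤ ≤ M ⊔ C := by
    intro a _
    have h₁ := associator_mem_commutatorSpan h2 isTwoSidedSubmodule_top
      (Submodule.mem_top (R := F) (x := a)) (Submodule.mem_top (x := y))
      (r := x)
    have h := Submodule.add_mem_sup (hmem (a - a * y)) (sub_mem (hC.left_mul_mem a hxy) h₁)
    convert h using 1
    simp only [mul_sub, mul_add, sub_mul]
    abel
  -- The same decomposition as for `hMC`, but `(c, y, x) = (y, c, x)` now puts the associator in `A
  -- C`.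
  have hle : M ⊔ C ≤ M ⊔ mulSpan ⊤ C := by
    refine sup_le le_sup_left fun c hc => ?_
    have h₁ := mul_mem_mulSpan (Submodule.mem_top (x := c)) hxy
    have h₂ := hAC.right_mul_mem x (mul_mem_mulSpan (Submodule.mem_top (x := y)) hc)
    have h₃ := mul_mem_mulSpan (Submodule.mem_top (x := y)) (hC.right_mul_mem x hc)
    have h := Submodule.add_mem_sup (hmem (c - c * y)) (add_mem (sub_mem h₁ h₂) h₃)
    convert h using 1
    simp only [mul_sub, mul_add, sub_mul]
    rw [NovikovRing.left_symm c y x]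
    abel
  obtain ⟨z, hz⟩ := hA.top_le_of_top_le_sup h2 hM (hMC.trans hle) (Submodule.mem_top (x := -x))
  refine ⟨z, ?_⟩
  have hz' : z - z * x = -x := hz
  rw [sub_eq_iff_eq_add] at hz'
  nth_rw 1 [hz']
  exact add_neg_cancel_left x _

/-! ### Field quotients from maximal right ideals. -/

/-- An element contained in every ideal with a field as quotient is left-quasiregular modulo
`[A, A]`. -/
theorem exists_add_sub_mul_mem_commutatorSpan (h2 : (2 : F) ≠ 0) {x : A}
    (hx : ∀ I : AlgIdeal F A, IsFieldAlgebra I.Quot → x ∈ I.toSubmodule) :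
    ∃ y : A, x + y - y * x ∈ commutatorSpan (F := F) (⊤ : Submodule F A) ⊤ := by
  by_contra! hne
  have hC := isTwoSidedSubmodule_top.commutatorSpan (F := F) (A := A) h2
  set C := commutatorSpan (F := F) (⊤ : Submodule F A) ⊤
  set M : Submodule F A := LinearMap.range (LinearMap.id - LinearMap.mulRight F x) ⊔ C
  have hxM : x ∉ M := by
    intro h
    obtain ⟨_, ⟨z, rfl⟩, c, hc, h⟩ := Submodule.mem_sup.1 h
    refine hne (-z) ?_
    have e : x + -z - -z * x = c := by
      rw [← eq_sub_iff_add_eq'] at h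
      rw [h]
      simp only [LinearMap.sub_apply, LinearMap.id_apply, LinearMap.mulRight_apply, neg_mul]
      abel
    rwa [e]
  have hMr : ∀ (a : A) {z : A}, z ∈ M → z * a ∈ M := by
    intro a z hz
    obtain ⟨_, ⟨z, rfl⟩, c, hc, rfl⟩ := Submodule.mem_sup.1 hz
    rw [add_mul]
    refine Submodule.add_mem_sup ⟨z * a, ?_⟩ (hC.right_mul_mem a hc)
    simp [sub_mul, NovikovRing.right_comm z a x]
  -- `N` is maximal among right ideals missing `x`. It contains `C`, so it is two-sided, and `x`
  -- becomes the identity of `A / N`.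
  obtain ⟨N, hMN, hN⟩ := zorn_le_nonempty₀
    {S : Submodule F A | x ∉ S ∧ ∀ (a : A) {z : A}, z ∈ S → z * a ∈ S}
    (fun c hc hchain S hS => by
      have hdir := hchain.directedOn
      refine ⟨sSup c, ⟨fun h => ?_, fun a z hz => ?_⟩, fun T hT => le_sSup hT⟩
      · obtain ⟨T, hT, hxT⟩ := (Submodule.mem_sSup_of_directed ⟨S, hS⟩ hdir).1 h
        exact (hc hT).1 hxT
      · obtain ⟨T, hT, hzT⟩ := (Submodule.mem_sSup_of_directed ⟨S, hS⟩ hdir).1 hz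
        exact (Submodule.mem_sSup_of_directed ⟨S, hS⟩ hdir).2 ⟨T, hT, (hc hT).2 a hzT⟩)
    M ⟨hxM, hMr⟩
  obtain ⟨⟨hxN, hNr⟩, hmax⟩ := hN
  have hcomm : ∀ a b : A, a * b - b * a ∈ N := fun a b =>
    hMN (Submodule.mem_sup_right (sub_mem_commutatorSpan trivial trivial : a * b - b * a ∈ C))
  have hunit : ∀ a : A, a - a * x ∈ N := fun a =>
    hMN (Submodule.mem_sup_left ⟨a, rfl⟩)
  have hNl : ∀ (a : A) {z : A}, z ∈ N → a * z ∈ N := fun a z hz => by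
    rw [← sub_add_cancel (a * z) (z * a)]
    exact add_mem (hcomm a z) (hNr a hz)
  let I : AlgIdeal F A := ⟨N, hNl, hNr⟩
  have hmk : ∀ {a b : A}, a - b ∈ N → I.toQuot a = I.toQuot b := fun h =>
    (Submodule.Quotient.eq N).2 h
  refine hxN (hx I ⟨fun u v => ?_, fun u v w => ?_, I.toQuot x, fun h => ?_, fun u => ?_,
    fun u hu => ?_⟩)
  · obtain ⟨a, rfl⟩ := I.toQuot_surjective u
    obtain ⟨b, rfl⟩ := I.toQuot_surjective v
    exact hmk (hcomm a b)
  · obtain ⟨a, rfl⟩ := I.toQuot_surjective u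
    obtain ⟨b, rfl⟩ := I.toQuot_surjective v
    obtain ⟨c, rfl⟩ := I.toQuot_surjective w
    exact hmk (hMN (Submodule.mem_sup_right (associator_mem_commutatorSpan (F := F) h2
      isTwoSidedSubmodule_top trivial trivial)))
  · exact hxN ((Submodule.Quotient.mk_eq_zero N).1 h)
  · obtain ⟨a, rfl⟩ := I.toQuot_surjective u
    refine hmk (a := x * a) (b := a) ?_
    rw [← sub_sub_sub_cancel_right _ _ (a * x)]
    exact sub_mem (hcomm x a) (hunit a)
  · obtain ⟨a, rfl⟩ := I.toQuot_surjective u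
    have haN : a ∉ N := fun h => hu ((Submodule.Quotient.mk_eq_zero N).2 h)
    by_contra! hinv
    -- If `a` is not invertible modulo `N`, then `N + a A` still misses `x`, so it equals `N`; but
    -- it contains `a = (a - a x) + a x`.
    have hxP : x ∉ N ⊔ LinearMap.range (LinearMap.mulLeft F a) := by
      intro h
      obtain ⟨n, hn, _, ⟨b, rfl⟩, h⟩ := Submodule.mem_sup.1 h
      refine hinv (I.toQuot b) (hmk (a := a * b) (b := x) ?_)
      have e : a * b - x = -n := by
        rw [← h, LinearMap.mulLeft_apply]; abel
      rw [e]
      exact neg_mem hn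
    have hPr : ∀ (d : A) {z : A}, z ∈ N ⊔ LinearMap.range (LinearMap.mulLeft F a) →
        z * d ∈ N ⊔ LinearMap.range (LinearMap.mulLeft F a) := by
      intro d z hz
      obtain ⟨n, hn, _, ⟨b, rfl⟩, rfl⟩ := Submodule.mem_sup.1 hz
      have h₁ : (a * b) * d - a * (b * d) ∈ N :=
        hMN (Submodule.mem_sup_right (associator_mem_commutatorSpan (F := F) h2
          isTwoSidedSubmodule_top trivial trivial))
      have h := Submodule.add_mem_sup (add_mem (hNr d hn) h₁)
        (LinearMap.mem_range_self (LinearMap.mulLeft F a) (b * d))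
      convert h using 1
      simp only [add_mul, LinearMap.mulLeft_apply]
      abel
    refine haN (hmax ⟨hxP, hPr⟩ le_sup_left ?_)
    have h := Submodule.add_mem_sup (hunit a)
      (LinearMap.mem_range_self (LinearMap.mulLeft F a) x)
    simpa using h

end NovikovIdeals

/-- A left-quasiregular ideal is contained in every ideal with a field as quotient. -/
theorem AlgIdeal.le_of_isLeftQuasiregularAlgebra {F A : Type*} [Field F] [NonUnitalNonAssocRing A]
    [Module F A] {I J : AlgIdeal F A} (hJ : IsLeftQuasiregularAlgebra J.toSubalgebra)
    (hI : IsFieldAlgebra I.Quot) : J.toSubmodule ≤ I.toSubmodule := by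
  intro a ha
  by_contra haI
  obtain ⟨hcomm, -, e, he, hone, hinv⟩ := hI
  obtain ⟨v, hv⟩ := hinv (I.toQuot a) fun h => haI ((Submodule.Quotient.mk_eq_zero _).1 h)
  obtain ⟨b, rfl⟩ := I.toQuot_surjective v
  -- `a b ∈ J` maps to `e`, so modulo `I` the relation reads `e + y = y`.
  obtain ⟨y, hy⟩ := hJ ⟨a * b, J.right_mul_mem b ha⟩
  have hy' : a * b + (y : A) = (y : A) * (a * b) := congrArg Subtype.val hy
  have h := congrArg I.toQuot hy'
  rw [I.toQuot_add, I.toQuot_mul _ (a * b), I.toQuot_mul a b, hv, hcomm _ e, hone] at h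
  exact he (add_eq_right.1 h)

theorem corollary3 (F A : Type*) [Field F] (hF : ringChar F ≠ 2)
    [NovikovRing A] [Module F A] [IsScalarTower F A A] [SMulCommClass F A A]
    (hA : IsLieSolvableAlgebra F A) :
    IsLeftQuasiregularAlgebra (leftQuasiregularRadical F A).toSubalgebra ∧
      (leftQuasiregularRadical F A).toSubmodule =
        sInf {S : Submodule F A | ∃ I : AlgIdeal F A,
          IsFieldAlgebra I.Quot ∧ S = I.toSubmodule} := by
  have h2 : (2 : F) ≠ 0 := Ring.two_ne_zero hF
  let N : AlgIdeal F A :=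
    { toSubmodule := sInf {S : Submodule F A | ∃ I : AlgIdeal F A,
        IsFieldAlgebra I.Quot ∧ S = I.toSubmodule}
      left_mul_mem := fun a x hx => by
        rw [Submodule.mem_sInf] at hx ⊢
        rintro _ ⟨I, hI, rfl⟩
        exact I.left_mul_mem a (hx _ ⟨I, hI, rfl⟩)
      right_mul_mem := fun a x hx => by
        rw [Submodule.mem_sInf] at hx ⊢
        rintro _ ⟨I, hI, rfl⟩
        exact I.right_mul_mem a (hx _ ⟨I, hI, rfl⟩) }
  have hle : (leftQuasiregularRadical F A).toSubmodule ≤ N.toSubmodule := by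
    refine sSup_le ?_
    rintro _ ⟨J, hJ, rfl⟩
    refine le_sInf ?_
    rintro _ ⟨I, hI, rfl⟩
    exact AlgIdeal.le_of_isLeftQuasiregularAlgebra hJ hI
  have helt : ∀ x ∈ N.toSubmodule, IsLeftQuasiregularElt x := by
    intro x hx
    obtain ⟨y, hy⟩ := exists_add_sub_mul_mem_commutatorSpan (F := F) h2 (x := x)
      fun I hI => (Submodule.mem_sInf.1 hx) _ ⟨I, hI, rfl⟩
    exact hA.isLeftQuasiregularElt h2 hy
  have hlqr : ∀ J : AlgIdeal F A, J.toSubmodule ≤ N.toSubmodule →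
      IsLeftQuasiregularAlgebra J.toSubalgebra := by
    rintro J hJN ⟨x, hx⟩
    obtain ⟨y, hy⟩ := helt x (hJN hx)
    -- The quasi-inverse found in `A` stays in the ideal, since `y = y x - x`.
    have hyJ : y ∈ J.toSubmodule := by
      rw [eq_sub_of_add_eq' hy]
      exact sub_mem (J.left_mul_mem y hx) hx
    exact ⟨⟨y, hyJ⟩, Subtype.ext hy⟩
  exact ⟨hlqr _ hle, le_antisymm hle (le_sSup ⟨N, hlqr N le_rfl, rfl⟩)⟩
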